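/- Let $(|k\rangle)_{k\in\mathbb Z}$ be the standard basis of $\ell^2(\mathbb Z)$, let $A$ be the adjacency operator of the line, $A|k\rangle=|k-1\rangle+|k+1\rangle$, and let $L_S=\tfrac12 A$. The stochastic quantum walk on the line with parameter $\omega\in[0,1]$ is the solution $\rho(t)$, $t\ge 0$, with $\rho(0)=|0\rangle\langle 0|$, of $$\dot\rho=-\mathrm i(1-\omega)[A,\rho]+\omega\Bigl(L_S\rho L_S^\dagger-\tfrac12\{L_S^\dagger L_S,\rho\}\Bigr).$$ Let $\omega=1$ (purely dissipative walk) and let $p_k(t)=\langle k|\rho(t)|k\rangle$. Then for every $t\ge 0$ the mean position $\bar k(t)=\sum_{k\in\mathbb Z}k\,p_k(t)$ and all central moments $\mu_m(t)=\sum_{k\in\mathbb Z}(k-\bar k(t))^m p_k(t)$, $m\in\{0,1,2,\dots\}$, are given by absolutely convergent series, $\bar k(t)=0$, and: 1. if $m$ is odd, then $\mu_m(t)=0$ for all $t\ge0$; 2. if $m$ is even, then $\mu_m(t)$ is, on $t\ge 0$, a polynomial in $t$ of degree exactly $m/2$ with real coefficients, and $$\lim_{t\to\infty}\frac{\mu_m(t)}{t^{m/2}}=\frac{m!}{(m/2)!\,8^{m/2}}\binom{m}{m/2};$$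 3. in particular, $\mu_2(t)=t/2$ for all $t\ge 0$. -/

import Mathlib

open scoped InnerProductSpace
open Filter Topology

noncomputable section

namespace StochasticWalk

section Flow

variable {V : Type*} [NormedAddCommGroup V] [NormedSpace ℂ V]

/-- The flow `exp (t G) v` of a bounded linear operator `G` on a Banach space. -/
def flow (G : V →L[ℂ] V) (v : V) (t : ℝ) : V := NormedSpace.exp ((t : ℂ) • G) v

theorem flow_zero (G : V →L[ℂ] V) (v : V) : flow G v 0 = v := by
  simp [flow]

theorem hasDerivAt_flow [CompleteSpace V] (G : V →L[ℂ] V) (v : V) (t : ℝ) :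
    HasDerivAt (flow G v) (G (flow G v t)) t := by
  have h := hasDerivAt_exp_smul_const' (𝕂 := ℂ) G (t : ℂ)
  have h2 := ((ContinuousLinearMap.apply ℂ V v)).hasFDerivAt.comp_hasDerivAt (t : ℂ) h
  have h3 := h2.scomp t (Complex.ofRealCLM.hasDerivAt (x := t))
  have h4 : HasDerivAt (flow G v) ((1 : ℂ) • G (flow G v t)) t := h3
  rwa [one_smul] at h4

theorem hasSum_flow [CompleteSpace V] (G : V →L[ℂ] V) (v : V) (t : ℝ) :
    HasSum (fun n : ℕ => ((n.factorial : ℂ)⁻¹ * (t : ℂ) ^ n) • (G ^ n) v) (flow G v t) := by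
  have hs := NormedSpace.exp_series_hasSum_exp' (𝕂 := ℂ) ((t : ℂ) • G)
  have hs' := ((ContinuousLinearMap.apply ℂ V v)).hasSum hs
  refine hs'.congr_fun ?_
  intro n
  rw [smul_pow, smul_smul]
  rfl

end Flow

section Lindblad

variable {E : Type*} [NormedAddCommGroup E] [InnerProductSpace ℂ E] [CompleteSpace E]

/-- The generator of the stochastic quantum walk with bounded Hamiltonian `H`, one bounded
dissipation operator `L` and mixing parameter `ω`, as a bounded superoperator:
`ρ ↦ -i (1 - ω) [H, ρ] + ω (L ρ L† - (1/2) {L† L, ρ})`. -/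
def generator (H L : E →L[ℂ] E) (ω : ℝ) : (E →L[ℂ] E) →L[ℂ] (E →L[ℂ] E) :=
  (-Complex.I * (1 - (ω : ℂ))) •
      (ContinuousLinearMap.mul ℂ (E →L[ℂ] E) H
        - (ContinuousLinearMap.mul ℂ (E →L[ℂ] E)).flip H)
    + (ω : ℂ) •
      (ContinuousLinearMap.mulLeftRight ℂ (E →L[ℂ] E) L (star L)
        - (1 / 2 : ℂ) •
          (ContinuousLinearMap.mul ℂ (E →L[ℂ] E) (star L * L)
            + (ContinuousLinearMap.mul ℂ (E →L[ℂ] E)).flip (star L * L)))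

theorem generator_apply (H L : E →L[ℂ] E) (ω : ℝ) (ρ : E →L[ℂ] E) :
    generator H L ω ρ =
      (-Complex.I * (1 - (ω : ℂ))) • (H * ρ - ρ * H)
        + (ω : ℂ) • (L * ρ * star L
            - (1 / 2 : ℂ) • (star L * L * ρ + ρ * (star L * L))) := by
  simp [generator]

/-- The state at time `t` of the stochastic quantum walk started from `ρ₀`: the exponential
`exp (t 𝓖)` of the generator `𝓖`, applied to `ρ₀`. -/
def evolve (H L : E →L[ℂ] E) (ω : ℝ) (ρ₀ : E →L[ℂ] E) (t : ℝ) : E →L[ℂ] E :=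
  flow (generator H L ω) ρ₀ t

theorem evolve_zero (H L : E →L[ℂ] E) (ω : ℝ) (ρ₀ : E →L[ℂ] E) :
    evolve H L ω ρ₀ 0 = ρ₀ :=
  flow_zero _ _

/-- The evolved state solves the master equation. -/
theorem hasDerivAt_evolve (H L : E →L[ℂ] E) (ω : ℝ) (ρ₀ : E →L[ℂ] E) (t : ℝ) :
    HasDerivAt (evolve H L ω ρ₀) (generator H L ω (evolve H L ω ρ₀ t)) t :=
  hasDerivAt_flow _ _ t

theorem isSelfAdjoint_generator {H : E →L[ℂ] E} (hH : IsSelfAdjoint H) (L : E →L[ℂ] E) (ω : ℝ)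
    {ρ : E →L[ℂ] E} (hρ : IsSelfAdjoint ρ) : IsSelfAdjoint (generator H L ω ρ) := by
  rw [isSelfAdjoint_iff] at *
  rw [generator_apply]
  have h1 : star (-Complex.I * (1 - (ω : ℂ))) = -(-Complex.I * (1 - (ω : ℂ))) := by
    simp
  have h2 : star (ω : ℂ) = ω := Complex.conj_ofReal ω
  have h3 : star (1 / 2 : ℂ) = 1 / 2 := by simp
  rw [star_add, star_smul, star_smul, star_sub, star_sub, star_smul, star_add, h1, h2, h3]
  simp only [star_mul, hH, hρ, star_star, mul_assoc]
  rw [add_comm (ρ * _), neg_smul, ← smul_neg, neg_sub]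

/-- A self-adjoint initial state stays self-adjoint. -/
theorem isSelfAdjoint_evolve {H : E →L[ℂ] E} (hH : IsSelfAdjoint H) (L : E →L[ℂ] E) (ω : ℝ)
    {ρ₀ : E →L[ℂ] E} (hρ : IsSelfAdjoint ρ₀) (t : ℝ) :
    IsSelfAdjoint (evolve H L ω ρ₀ t) := by
  have hpow : ∀ n : ℕ, IsSelfAdjoint ((generator H L ω ^ n) ρ₀) := by
    intro n
    induction n with
    | zero => simpa using hρ
    | succ n ih =>
      rw [pow_succ']
      exact isSelfAdjoint_generator hH L ω ih
  have hs := hasSum_flow (generator H L ω) ρ₀ t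
  have he : ∀ n : ℕ,
      star (((n.factorial : ℂ)⁻¹ * (t : ℂ) ^ n) • (generator H L ω ^ n) ρ₀)
        = ((n.factorial : ℂ)⁻¹ * (t : ℂ) ^ n) • (generator H L ω ^ n) ρ₀ := by
    intro n
    rw [star_smul, (hpow n).star_eq]
    simp
  have hs' := hs.star
  simp only [he] at hs'
  exact hs'.unique hs

end Lindblad

/-- The Hilbert space `ℓ²(ℤ)` of a walker on the line. -/
abbrev LineSpace : Type := lp (fun _ : ℤ => ℂ) 2

/-- The position basis vector `|k⟩`. -/
def ket (k : ℤ) : LineSpace := lp.single 2 k 1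

theorem memLp_shift (a : ℤ) (ψ : LineSpace) : Memℓp (fun i : ℤ => ψ (i + a)) 2 := by
  refine memℓp_gen ?_
  have h := (lp.memℓp ψ).summable (by norm_num)
  exact (Equiv.addRight a).summable_iff.mpr h

/-- The translation `(T_a ψ)(i) = ψ(i + a)` of `ℓ²(ℤ)`. -/
def shift (a : ℤ) : LineSpace →L[ℂ] LineSpace :=
  LinearMap.mkContinuous
    { toFun := fun ψ => ⟨fun i => ψ (i + a), memLp_shift a ψ⟩
      map_add' := fun _ _ => rfl
      map_smul' := fun _ _ => rfl } 1 (by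
    intro ψ
    rw [one_mul]
    refine lp.norm_le_of_tsum_le (by norm_num) (norm_nonneg _) ?_
    rw [lp.norm_rpow_eq_tsum (by norm_num) ψ]
    exact ((Equiv.addRight a).tsum_eq (fun i => ‖ψ i‖ ^ (2 : ENNReal).toReal)).le)

@[simp] theorem shift_apply (a : ℤ) (ψ : LineSpace) (i : ℤ) : shift a ψ i = ψ (i + a) := rfl

/-- The adjacency operator of the line: `(A ψ)(i) = ψ(i + 1) + ψ(i - 1)`. -/
def adjacency : LineSpace →L[ℂ] LineSpace := shift 1 + shift (-1)

theorem adjacency_apply (ψ : LineSpace) (i : ℤ) : adjacency ψ i = ψ (i + 1) + ψ (i - 1) := rfl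

theorem inner_ket (k : ℤ) (ψ : LineSpace) : ⟪ket k, ψ⟫_ℂ = ψ k := by
  simp [ket, lp.inner_single_left]

/-- Matrix elements of the adjacency operator. -/
theorem inner_adjacency (i j : ℤ) :
    ⟪ket i, adjacency (ket j)⟫_ℂ = if j = i + 1 ∨ i = j + 1 then 1 else 0 := by
  rw [inner_ket, adjacency_apply]
  simp only [ket, lp.coeFn_single, Pi.single_apply]
  split_ifs <;> first | omega | simp

theorem isSelfAdjoint_adjacency : IsSelfAdjoint adjacency := by
  rw [ContinuousLinearMap.isSelfAdjoint_iff_isSymmetric]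
  intro φ ψ
  have hsum : ∀ (f g : LineSpace) (a : ℤ), ⟪shift a f, g⟫_ℂ = ⟪f, shift (-a) g⟫_ℂ := by
    intro f g a
    rw [lp.inner_eq_tsum, lp.inner_eq_tsum,
      ← (Equiv.addRight a).tsum_eq (fun i => ⟪f i, shift (-a) g i⟫_ℂ)]
    simp
  change ⟪shift 1 φ + shift (-1) φ, ψ⟫_ℂ = ⟪φ, shift 1 ψ + shift (-1) ψ⟫_ℂ
  rw [inner_add_left, inner_add_right, hsum, hsum, neg_neg, add_comm]

/-- The local jump operator `(1/2) |n⟩⟨m|` along an edge from `m` to `n` (every vertex of the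
line has degree two). -/
def jump (m n : ℤ) : LineSpace →L[ℂ] LineSpace :=
  (1 / 2 : ℂ) • InnerProductSpace.rankOne ℂ (ket n) (ket m)

/-- The global dissipation operator `L_S`, half of the adjacency operator. -/
def globalDissipator : LineSpace →L[ℂ] LineSpace := (1 / 2 : ℂ) • adjacency

theorem hasSum_shift (a : ℤ) (ψ : LineSpace) :
    HasSum (fun i : ℤ => InnerProductSpace.rankOne ℂ (ket i) (ket (i + a)) ψ) (shift a ψ) := by
  have h := lp.hasSum_single (p := 2) (by norm_num) (shift a ψ)
  refine h.congr_fun ?_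
  intro i
  rw [InnerProductSpace.rankOne_apply, inner_ket, ket, ← lp.single_smul]
  simp

/-- `L_S` is the (strongly convergent) sum of all the local jump operators of the line. -/
theorem hasSum_jump (ψ : LineSpace) :
    HasSum (fun i : ℤ => jump (i + 1) i ψ + jump i (i + 1) ψ) (globalDissipator ψ) := by
  have h1 := hasSum_shift 1 ψ
  have h2 := (Equiv.addRight (1 : ℤ)).hasSum_iff.mpr (hasSum_shift (-1) ψ)
  have h := (h1.add h2).const_smul (1 / 2 : ℂ)
  refine h.congr_fun ?_
  intro i
  simp [jump, smul_add]

/-- The state at time `t` of the walk on the line with mixing parameter `ω`, Hamiltonian the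
adjacency operator and dissipation operator `L_S`, started from `|0⟩⟨0|`. -/
def lineState (ω t : ℝ) : LineSpace →L[ℂ] LineSpace :=
  evolve adjacency globalDissipator ω (InnerProductSpace.rankOne ℂ (ket 0) (ket 0)) t

/-- The probability `⟨k|ρ(t)|k⟩` of finding the walker at `k` at time `t`. -/
def positionProb (ω t : ℝ) (k : ℤ) : ℝ := (⟪ket k, lineState ω t (ket k)⟫_ℂ).re

/-- The diagonal matrix elements of `ρ(t)` are real, so that taking real parts loses nothing. -/
theorem coe_positionProb (ω t : ℝ) (k : ℤ) :
    ((positionProb ω t k : ℝ) : ℂ) = ⟪ket k, lineState ω t (ket k)⟫_ℂ := by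
  have h0 : IsSelfAdjoint (InnerProductSpace.rankOne ℂ (ket 0) (ket 0)) := by
    rw [ContinuousLinearMap.isSelfAdjoint_iff_isSymmetric]
    intro φ ψ
    simp [inner_smul_left, inner_smul_right]
    ring
  have h := isSelfAdjoint_evolve isSelfAdjoint_adjacency globalDissipator ω h0 t
  rw [ContinuousLinearMap.isSelfAdjoint_iff_isSymmetric] at h
  have h' := h.coe_re_inner_self_apply (ket k)
  have h2 := h (ket k) (ket k)
  exact (Complex.conj_eq_iff_re.mp (by rw [inner_conj_symm]; exact h2))

/-- The mean position of the walker at time `t`. -/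
def meanPosition (ω t : ℝ) : ℝ := ∑' k : ℤ, (k : ℝ) * positionProb ω t k

/-- The `m`-th central moment of the position of the walker at time `t`. -/
def centralMoment (ω : ℝ) (m : ℕ) (t : ℝ) : ℝ :=
  ∑' k : ℤ, ((k : ℝ) - meanPosition ω t) ^ m * positionProb ω t k

end StochasticWalk

end

/-! For `ω = 1` and the self-adjoint dissipation operator `A / 2` the generator is the double
commutator `ρ ↦ -[A, [A, ρ]] / 8`. In the rotated coordinates `i - j`, `i + j`, and up to the sign
`(-1)ⁱ`, the commutator with `A` makes independent nearest-neighbour steps in both coordinates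
(`commutator_adjacency_of_walkCount`), so that the powers of the generator applied to `|0⟩⟨0|` have
products of two binomial coefficients as matrix elements (`generator_pow_apply`). On the diagonal
this gives
`p_k(t) = ∑ₙ (-t/8)ⁿ / n! * C(2n, n) * (-1)ᵏ C(2n, n + k)` (`hasSum_positionProb`).

The factor `(-1)ᵏ C(2n, n + k)` is symmetric in `k`, whence the odd moments vanish. Its `m`-th
moment is, up to the sign `(-1)ⁿ`, a finite difference of order `2n` of `xᵐ`
(`kernelMoment_eq_fwdDiff`): it vanishes when `2n > m` and is `m!` up to sign when `2n = m`. Since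
the double series over `n` and `k` converges absolutely (`summable_momentTerm`), the `m`-th moment
may be computed by summing over `k` first, which leaves a polynomial of degree `m / 2` in `t` with
explicit leading coefficient (`tsum_pow_mul_positionProb_two_mul`, `momentPolynomial_coeff_self`).
-/

namespace StochasticWalk

/-! ### Counting walks on the line -/

/-- The number of walks of length `N` on `ℤ` (steps `±1`) from `0` to `a`. -/
def walkCount : ℕ → ℤ → ℕ
  | 0, a => if a = 0 then 1 else 0
  | N + 1, a => walkCount N (a + 1) + walkCount N (a - 1)

theorem walkCount_eq_zero {N : ℕ} {a : ℤ} (h : (N : ℤ) < |a|) : walkCount N a = 0 := by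
  induction N generalizing a with
  | zero =>
    have : a ≠ 0 := by rintro rfl; simp at h
    simp [walkCount, this]
  | succ N ih =>
    have h1 : (N : ℤ) < |a + 1| ∧ (N : ℤ) < |a - 1| := by grind
    simp [walkCount, ih h1.1, ih h1.2]

theorem walkCount_neg (N : ℕ) (a : ℤ) : walkCount N (-a) = walkCount N a := by
  induction N generalizing a with
  | zero => simp [walkCount]
  | succ N ih =>
    rw [walkCount, walkCount, ← ih (a + 1), ← ih (a - 1), add_comm]
    congr 2 <;> ring

theorem walkCount_two_mul_sub (N j : ℕ) : walkCount N (2 * j - N) = N.choose j := by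
  induction N generalizing j with
  | zero => cases j <;> simp [walkCount]; omega
  | succ N ih =>
    rw [walkCount]
    cases j with
    | zero =>
      rw [walkCount_eq_zero (a := _ - 1) (by push_cast; grind)]
      have := ih 0
      rw [Nat.choose_zero_right] at this ⊢
      refine (add_zero _).trans (Eq.trans ?_ this)
      congr 1; push_cast; ring
    | succ j =>
      rw [Nat.choose_succ_succ, ← ih j, ← ih (j + 1), add_comm]
      congr 2 <;> push_cast <;> ring

theorem walkCount_two_mul_zero (n : ℕ) : walkCount (2 * n) 0 = n.centralBinom := by
  have := walkCount_two_mul_sub (2 * n) n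
  rwa [show (2 * (n : ℤ) - ((2 * n : ℕ) : ℤ)) = 0 by push_cast; ring,
    ← Nat.centralBinom_eq_two_mul_choose] at this

/-- The signed walk count `(-1)ᵏ C(2n, n + k)`: the kernel, at distance `k`, of the `n`-th power of
the negative second difference `f ↦ -(f (· + 1) - 2 f + f (· - 1))`. -/
noncomputable def differenceKernel (n : ℕ) (k : ℤ) : ℝ := (-1) ^ k * walkCount (2 * n) (2 * k)

theorem differenceKernel_eq_zero {n : ℕ} {k : ℤ} (h : k ∉ Finset.Icc (-n : ℤ) n) :
    differenceKernel n k = 0 := by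
  rw [differenceKernel, walkCount_eq_zero, Nat.cast_zero, mul_zero]
  rw [Finset.mem_Icc] at h
  push_cast
  grind

theorem differenceKernel_neg (n : ℕ) (k : ℤ) :
    differenceKernel n (-k) = differenceKernel n k := by
  rw [differenceKernel, differenceKernel, mul_neg, walkCount_neg, zpow_neg, ← inv_zpow]
  norm_num

theorem sum_Icc_neg_natCast {M : Type*} [AddCommMonoid M] (n : ℕ) (f : ℤ → M) :
    ∑ k ∈ Finset.Icc (-n : ℤ) n, f k = ∑ j ∈ Finset.range (2 * n + 1), f (j - n) := by
  symm
  refine Finset.sum_bij (fun j _ => (j : ℤ) - n) ?_ ?_ ?_ ?_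
  · intro j hj
    simp only [Finset.mem_range, Finset.mem_Icc] at hj ⊢
    omega
  · intro i _ j _ h
    simpa using h
  · intro k hk
    rw [Finset.mem_Icc] at hk
    refine ⟨(k + n).toNat, ?_, ?_⟩
    · rw [Finset.mem_range]; omega
    · omega
  · intros; rfl

theorem differenceKernel_sub (n j : ℕ) :
    differenceKernel n (j - n) = (-1) ^ n * ((-1) ^ j * (2 * n).choose j) := by
  have h := walkCount_two_mul_sub (2 * n) j
  rw [differenceKernel, show 2 * ((j : ℤ) - n) = 2 * j - (2 * n : ℕ) by push_cast; ring, h,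
    zpow_sub₀ (by norm_num), zpow_natCast, zpow_natCast, div_eq_mul_inv, ← inv_pow]
  norm_num
  ring

/-- The `m`-th moment of the difference kernel of order `n`. -/
noncomputable def kernelMoment (m n : ℕ) : ℝ :=
  ∑ k ∈ Finset.Icc (-n : ℤ) n, (k : ℝ) ^ m * differenceKernel n k

theorem kernelMoment_eq_fwdDiff (m n : ℕ) :
    kernelMoment m n = (-1) ^ n * (fwdDiff 1)^[2 * n] (fun x : ℝ => x ^ m) (-n) := by
  rw [kernelMoment, sum_Icc_neg_natCast, fwdDiff_iter_eq_sum_shift, Finset.mul_sum]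
  refine Finset.sum_congr rfl fun j hj => ?_
  have hj' : j ≤ 2 * n := by simpa [Nat.lt_succ_iff] using hj
  have hs : (-1 : ℝ) ^ (2 * n - j) = (-1) ^ j := by
    refine neg_one_pow_congr ?_
    rw [Nat.even_sub hj']
    simp
  rw [differenceKernel_sub, zsmul_eq_mul]
  push_cast
  rw [hs]
  simp only [nsmul_eq_mul, mul_one]
  ring

theorem kernelMoment_eq_zero {m n : ℕ} (h : m < 2 * n) : kernelMoment m n = 0 := by
  rw [kernelMoment_eq_fwdDiff, fwdDiff_iter_pow_eq_zero_of_lt h]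
  simp

theorem kernelMoment_two_mul (n : ℕ) :
    kernelMoment (2 * n) n = (-1) ^ n * (2 * n).factorial := by
  rw [kernelMoment_eq_fwdDiff, fwdDiff_iter_eq_factorial]
  simp

theorem sum_abs_kernelMoment_le (m n : ℕ) :
    ∑ k ∈ Finset.Icc (-n : ℤ) n, |(k : ℝ) ^ m * differenceKernel n k| ≤ (n : ℝ) ^ m * 4 ^ n := by
  have h4 : ∑ k ∈ Finset.Icc (-n : ℤ) n, |differenceKernel n k| = (4 : ℝ) ^ n := by
    rw [sum_Icc_neg_natCast]
    have := Nat.sum_range_choose (2 * n)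
    rw [pow_mul] at this
    norm_num at this
    rw [show (4 : ℝ) ^ n = ((4 ^ n : ℕ) : ℝ) by push_cast; rfl, ← this]
    push_cast
    refine Finset.sum_congr rfl fun j _ => ?_
    rw [differenceKernel_sub]
    simp [abs_mul]
  rw [← h4, Finset.mul_sum]
  refine Finset.sum_le_sum fun k hk => ?_
  rw [abs_mul, abs_pow]
  rw [Finset.mem_Icc] at hk
  gcongr
  rw [← Int.cast_abs]
  exact_mod_cast abs_le.mpr hk

/-! ### Matrix elements of the purely dissipative generator -/

theorem globalDissipator_star : star globalDissipator = globalDissipator := by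
  rw [globalDissipator, star_smul, isSelfAdjoint_adjacency.star_eq]
  simp

/-- For a self-adjoint dissipation operator the dissipator is a double commutator. -/
theorem generator_one_apply (ρ : LineSpace →L[ℂ] LineSpace) :
    generator adjacency globalDissipator 1 ρ =
      (-1 / 8 : ℂ) • (adjacency * (adjacency * ρ - ρ * adjacency)
        - (adjacency * ρ - ρ * adjacency) * adjacency) := by
  rw [generator_apply, globalDissipator_star]
  simp only [globalDissipator, mul_sub, sub_mul, smul_mul_assoc, mul_smul_comm, smul_smul,
    ← mul_assoc, Complex.ofReal_one, sub_self, mul_zero, zero_smul, zero_add, one_smul]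
  module

theorem adjacency_ket (j : ℤ) : adjacency (ket j) = ket (j + 1) + ket (j - 1) := by
  ext i
  rw [adjacency_apply]
  simp only [ket, lp.coeFn_add, lp.coeFn_single, Pi.add_apply, Pi.single_apply]
  rw [add_comm]
  congr 2 <;> simp only [eq_iff_iff] <;> omega

theorem commutator_adjacency_apply (ρ : LineSpace →L[ℂ] LineSpace) (i j : ℤ) :
    (adjacency * ρ - ρ * adjacency) (ket j) i =
      ρ (ket j) (i + 1) + ρ (ket j) (i - 1) - (ρ (ket (j + 1)) i + ρ (ket (j - 1)) i) := by
  change (adjacency (ρ (ket j)) - ρ (adjacency (ket j)) : LineSpace) i = _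
  rw [adjacency_ket, map_add]
  rfl

/-- Commutation with the adjacency operator takes one step of the walk in each of the rotated
coordinates `i - j` and `i + j` of the matrix. -/
theorem commutator_adjacency_of_walkCount {ρ : LineSpace →L[ℂ] LineSpace} {c : ℂ} {N : ℕ}
    (h : ∀ i j : ℤ, ρ (ket j) i = c * (-1) ^ i * (walkCount N (i - j) * walkCount N (i + j)))
    (i j : ℤ) :
    (adjacency * ρ - ρ * adjacency) (ket j) i =
      -c * (-1) ^ i * (walkCount (N + 1) (i - j) * walkCount (N + 1) (i + j)) := by
  rw [commutator_adjacency_apply, h, h, h, h, walkCount, walkCount,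
    zpow_add_one₀ (by norm_num), zpow_sub_one₀ (by norm_num)]
  push_cast
  rw [show i + 1 - j = i - j + 1 by ring, show i + 1 + j = i + j + 1 by ring,
    show i - 1 - j = i - j - 1 by ring, show i - 1 + j = i + j - 1 by ring,
    show i - (j + 1) = i - j - 1 by ring, show i + (j + 1) = i + j + 1 by ring,
    show i - (j - 1) = i - j + 1 by ring, show i + (j - 1) = i + j - 1 by ring]
  norm_num
  ring

theorem generator_pow_apply (n : ℕ) (i j : ℤ) :
    (generator adjacency globalDissipator 1 ^ n)
      (InnerProductSpace.rankOne ℂ (ket 0) (ket 0)) (ket j) i =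
      (-1 / 8) ^ n * (-1) ^ i * (walkCount (2 * n) (i - j) * walkCount (2 * n) (i + j)) := by
  induction n generalizing i j with
  | zero =>
    simp only [pow_zero, one_apply_eq_self, InnerProductSpace.rankOne_apply, inner_ket,
      walkCount, one_mul]
    simp only [ket, lp.coeFn_smul, lp.coeFn_single, Pi.smul_apply, Pi.single_apply, smul_eq_mul]
    by_cases hi : i = 0
    · subst hi; by_cases hj : j = 0 <;> simp [hj, eq_comm]
    · have : ¬ (i - j = 0 ∧ i + j = 0) := by omega
      by_cases h1 : i - j = 0 <;> by_cases h2 : i + j = 0 <;> simp_all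
  | succ n ih =>
    have h := commutator_adjacency_of_walkCount (commutator_adjacency_of_walkCount ih) i j
    rw [pow_succ', mul_apply_eq_comp, generator_one_apply]
    refine (congrArg ((-1 / 8 : ℂ) * ·) h).trans ?_
    rw [show 2 * (n + 1) = 2 * n + 1 + 1 by ring]
    ring

/-- The power series in `t` of the position distribution of the purely dissipative walk. -/
theorem hasSum_positionProb (t : ℝ) (k : ℤ) :
    HasSum (fun n : ℕ => (-t / 8) ^ n / n.factorial * n.centralBinom * differenceKernel n k)
      (positionProb 1 t k) := by
  have h := hasSum_flow (generator adjacency globalDissipator 1)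
    (InnerProductSpace.rankOne ℂ (ket 0) (ket 0)) t
  have h2 := Complex.reCLM.hasSum
    (((innerSL ℂ (ket k)).comp (ContinuousLinearMap.apply ℂ LineSpace (ket k))).hasSum h)
  refine h2.congr_fun fun n => Eq.symm ?_
  change Complex.re (⟪ket k, ((n.factorial : ℂ)⁻¹ * (t : ℂ) ^ n) •
    (generator adjacency globalDissipator 1 ^ n)
      (InnerProductSpace.rankOne ℂ (ket 0) (ket 0)) (ket k)⟫_ℂ) = _
  rw [inner_smul_right, inner_ket, generator_pow_apply, sub_self, walkCount_two_mul_zero,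
    ← two_mul, ← Complex.ofReal_re (_ * differenceKernel n k)]
  congr 1
  rw [differenceKernel]
  push_cast
  rw [div_pow, div_pow, neg_pow (t : ℂ)]
  ring

/-! ### Moments of the position distribution -/

/-- The `n`-th term, at position `k`, of the power series in `t` of `kᵐ p_k(t)`. -/
noncomputable def momentTerm (m : ℕ) (t : ℝ) (n : ℕ) (k : ℤ) : ℝ :=
  (-t / 8) ^ n / n.factorial * n.centralBinom * ((k : ℝ) ^ m * differenceKernel n k)

theorem momentTerm_eq_zero {m : ℕ} {t : ℝ} {n : ℕ} {k : ℤ} (h : k ∉ Finset.Icc (-n : ℤ) n) :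
    momentTerm m t n k = 0 := by
  rw [momentTerm, differenceKernel_eq_zero h, mul_zero, mul_zero]

theorem hasSum_momentTerm_left (m : ℕ) (t : ℝ) (k : ℤ) :
    HasSum (fun n => momentTerm m t n k) ((k : ℝ) ^ m * positionProb 1 t k) := by
  refine ((hasSum_positionProb t k).mul_left ((k : ℝ) ^ m)).congr_fun fun n => ?_
  rw [momentTerm]
  ring

theorem hasSum_momentTerm_right (m : ℕ) (t : ℝ) (n : ℕ) :
    HasSum (momentTerm m t n)
      ((-t / 8) ^ n / n.factorial * n.centralBinom * kernelMoment m n) := by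
  rw [kernelMoment, Finset.mul_sum]
  exact hasSum_sum_of_ne_finset_zero fun k hk => momentTerm_eq_zero hk

/-- Summed over the positions, the terms of order `n` are dominated by those of an exponential
series: the binomial coefficients grow only like `4ⁿ` and the support has radius `n`. -/
theorem sum_abs_momentTerm_le (m : ℕ) (t : ℝ) (n : ℕ) :
    ∑ k ∈ Finset.Icc (-n : ℤ) n, |momentTerm m t n k| ≤
      m.factorial * ((2 * Real.exp 1 * |t|) ^ n / n.factorial) := by
  have hc : (n.centralBinom : ℝ) ≤ 4 ^ n := by
    have := Nat.choose_le_two_pow (2 * n) n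
    rw [pow_mul] at this
    exact_mod_cast this
  have hm : (n : ℝ) ^ m ≤ m.factorial * Real.exp 1 ^ n := by
    have := Real.pow_div_factorial_le_exp (n : ℝ) n.cast_nonneg m
    rw [div_le_iff₀ (by positivity)] at this
    rwa [← Real.exp_nat_mul, mul_one, mul_comm]
  calc ∑ k ∈ Finset.Icc (-n : ℤ) n, |momentTerm m t n k|
      = |t| ^ n / 8 ^ n / n.factorial * n.centralBinom *
          ∑ k ∈ Finset.Icc (-n : ℤ) n, |(k : ℝ) ^ m * differenceKernel n k| := by
        rw [Finset.mul_sum]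
        refine Finset.sum_congr rfl fun k _ => ?_
        rw [momentTerm, abs_mul]
        congr 1
        simp [abs_mul, abs_div, div_pow]
    _ ≤ |t| ^ n / 8 ^ n / n.factorial * 4 ^ n *
          ((m.factorial * Real.exp 1 ^ n) * 4 ^ n) := by
        gcongr
        exact (sum_abs_kernelMoment_le m n).trans (by gcongr)
    _ = _ := by
        have h8 : (4 : ℝ) ^ n * 4 ^ n = 8 ^ n * 2 ^ n := by
          rw [← mul_pow, ← mul_pow]; norm_num
        rw [mul_pow, mul_pow]
        field_simp
        rw [pow_two, h8]
        ring

/-- The double series behind every moment converges absolutely. -/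
theorem summable_momentTerm (m : ℕ) (t : ℝ) :
    Summable fun x : ℕ × ℤ => momentTerm m t x.1 x.2 := by
  rw [← summable_abs_iff, summable_prod_of_nonneg fun _ => abs_nonneg _]
  have h (n : ℕ) : HasSum (fun k => |momentTerm m t n k|)
      (∑ k ∈ Finset.Icc (-n : ℤ) n, |momentTerm m t n k|) :=
    hasSum_sum_of_ne_finset_zero fun k hk => by rw [momentTerm_eq_zero hk, abs_zero]
  refine ⟨fun n => (h n).summable, ?_⟩
  simp only [(h _).tsum_eq]
  exact ((Real.summable_pow_div_factorial _).mul_left _).of_nonneg_of_le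
    (fun n => Finset.sum_nonneg fun _ _ => abs_nonneg _) (sum_abs_momentTerm_le m t)

theorem summable_pow_mul_positionProb (m : ℕ) (t : ℝ) :
    Summable fun k : ℤ => (k : ℝ) ^ m * positionProb 1 t k := by
  have h := (summable_momentTerm m t).prod_symm.prod
  simpa only [Prod.fst_swap, Prod.snd_swap, (hasSum_momentTerm_left m t _).tsum_eq] using h

theorem positionProb_neg (t : ℝ) (k : ℤ) : positionProb 1 t (-k) = positionProb 1 t k := by
  have h := hasSum_positionProb t (-k)
  simp only [differenceKernel_neg] at h
  exact h.unique (hasSum_positionProb t k)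

theorem tsum_pow_mul_positionProb_of_odd {m : ℕ} (hm : Odd m) (t : ℝ) :
    ∑' k : ℤ, (k : ℝ) ^ m * positionProb 1 t k = 0 := by
  have h := (Equiv.neg ℤ).tsum_eq fun k : ℤ => (k : ℝ) ^ m * positionProb 1 t k
  simp only [Equiv.neg_apply, positionProb_neg, Int.cast_neg, hm.neg_pow, neg_mul, tsum_neg] at h
  linarith

/-- The polynomial in `t` that equals the `2q`-th moment. -/
noncomputable def momentPolynomial (q : ℕ) : Polynomial ℝ :=
  ∑ n ∈ Finset.range (q + 1), Polynomial.monomial n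
    ((-1 / 8) ^ n / n.factorial * n.centralBinom * kernelMoment (2 * q) n)

/-- Only finitely many powers of `t` contribute, since a difference of order `2n > m` annihilates
`xᵐ`. -/
theorem tsum_pow_mul_positionProb_two_mul (q : ℕ) (t : ℝ) :
    ∑' k : ℤ, (k : ℝ) ^ (2 * q) * positionProb 1 t k = (momentPolynomial q).eval t := by
  have h := Summable.tsum_comm (f := momentTerm (2 * q) t) (summable_momentTerm (2 * q) t)
  simp only [(hasSum_momentTerm_left _ t _).tsum_eq, (hasSum_momentTerm_right _ t _).tsum_eq] at h
  rw [h, tsum_eq_sum (s := Finset.range (q + 1)), momentPolynomial, Polynomial.eval_finsetSum]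
  · refine Finset.sum_congr rfl fun n _ => ?_
    rw [Polynomial.eval_monomial, show -t / 8 = -1 / 8 * t by ring, mul_pow]
    ring
  · intro n hn
    rw [Finset.mem_range] at hn
    rw [kernelMoment_eq_zero (by omega), mul_zero]

theorem momentPolynomial_coeff_self (q : ℕ) :
    (momentPolynomial q).coeff q =
      (2 * q).factorial / (q.factorial * 8 ^ q) * (2 * q).choose q := by
  rw [momentPolynomial, Polynomial.finsetSum_coeff, Finset.sum_eq_single q]
  · rw [Polynomial.coeff_monomial_same, kernelMoment_two_mul, Nat.centralBinom_eq_two_mul_choose,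
      div_pow]
    have : (-1 : ℝ) ^ q * (-1) ^ q = 1 := by rw [← mul_pow]; norm_num
    field_simp
    rw [pow_two, this, one_mul]
  · intro n _ hn
    exact Polynomial.coeff_monomial_of_ne _ hn.symm
  · simp

theorem momentPolynomial_degree (q : ℕ) : (momentPolynomial q).degree = q := by
  refine le_antisymm ?_ (Polynomial.le_degree_of_ne_zero ?_)
  · refine (Polynomial.degree_sum_le _ _).trans (Finset.sup_le fun n hn => ?_)
    refine (Polynomial.degree_monomial_le _ _).trans ?_
    rw [Finset.mem_range] at hn
    exact_mod_cast Nat.lt_succ_iff.mp hn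
  · rw [momentPolynomial_coeff_self]
    have := Nat.choose_pos (show q ≤ 2 * q by omega)
    positivity

theorem momentPolynomial_one : momentPolynomial 1 = Polynomial.monomial 1 (1 / 2) := by
  have h0 : kernelMoment (2 * 1) 0 = 0 := by simp [kernelMoment]
  rw [momentPolynomial, Finset.sum_range_succ, Finset.sum_range_one, h0, kernelMoment_two_mul,
    Nat.centralBinom_eq_two_mul_choose 1, mul_zero, Polynomial.monomial_zero_right, zero_add]
  congr 1
  norm_num

theorem meanPosition_one (t : ℝ) : meanPosition 1 t = 0 := by
  simpa [meanPosition] using tsum_pow_mul_positionProb_of_odd odd_one t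

theorem centralMoment_one (m : ℕ) (t : ℝ) :
    centralMoment 1 m t = ∑' k : ℤ, (k : ℝ) ^ m * positionProb 1 t k := by
  simp only [centralMoment, meanPosition_one, sub_zero]

end StochasticWalk

theorem proposition5 :
    (∀ t : ℝ, 0 ≤ t →
      Summable (fun k : ℤ => (k : ℝ) * StochasticWalk.positionProb 1 t k) ∧
      StochasticWalk.meanPosition 1 t = 0 ∧
      ∀ m : ℕ, Summable (fun k : ℤ => ((k : ℝ) - StochasticWalk.meanPosition 1 t) ^ m *
        StochasticWalk.positionProb 1 t k)) ∧
    (∀ m : ℕ, Odd m → ∀ t : ℝ, 0 ≤ t → StochasticWalk.centralMoment 1 m t = 0) ∧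
    (∀ m : ℕ, Even m →
      (∃ P : Polynomial ℝ, P.degree = ((m / 2 : ℕ) : WithBot ℕ) ∧
        ∀ t : ℝ, 0 ≤ t → StochasticWalk.centralMoment 1 m t = P.eval t) ∧
      Tendsto (fun t : ℝ => StochasticWalk.centralMoment 1 m t / t ^ (m / 2)) atTop
        (𝓝 ((m.factorial : ℝ) / (((m / 2).factorial : ℝ) * 8 ^ (m / 2)) *
          (m.choose (m / 2) : ℝ)))) ∧
    (∀ t : ℝ, 0 ≤ t → StochasticWalk.centralMoment 1 2 t = t / 2) := by
  open StochasticWalk in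
  refine ⟨fun t _ => ⟨?_, meanPosition_one t, fun m => ?_⟩, fun m hm t _ => ?_, ?_, fun t _ => ?_⟩
  · simpa using summable_pow_mul_positionProb 1 t
  · simpa [meanPosition_one] using summable_pow_mul_positionProb m t
  · rw [centralMoment_one, tsum_pow_mul_positionProb_of_odd hm]
  · rintro m ⟨q, rfl⟩
    have hq : (q + q) / 2 = q := by omega
    rw [hq, ← two_mul]
    have hP (t : ℝ) : centralMoment 1 (2 * q) t = (momentPolynomial q).eval t := by
      rw [centralMoment_one, tsum_pow_mul_positionProb_two_mul]
    refine ⟨⟨_, momentPolynomial_degree q, fun t _ => hP t⟩, ?_⟩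
    have h := Polynomial.div_tendsto_atTop_leadingCoeff_div_of_degree_eq (momentPolynomial q)
      (Polynomial.X ^ q) (by rw [momentPolynomial_degree, Polynomial.degree_X_pow])
    rw [Polynomial.leadingCoeff_X_pow, div_one, Polynomial.leadingCoeff,
      Polynomial.natDegree_eq_of_degree_eq_some (momentPolynomial_degree q),
      momentPolynomial_coeff_self] at h
    simpa only [hP, Polynomial.eval_pow, Polynomial.eval_X] using h
  · rw [centralMoment_one, show (2 : ℕ) = 2 * 1 from rfl, tsum_pow_mul_positionProb_two_mul,
      momentPolynomial_one, Polynomial.eval_monomial]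
    ring
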